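/- Let $H$ be a complete Heyting algebra (a set). A presheaf on $H$ is a functor $P:H^{op}\to\mathbf{Set}$; write $x|_k$ for the restriction of $x\in P(h)$ to $k\le h$. It is a sheaf if for every $A\subseteq H$ and every family $\langle x_k\in P(k)\rangle_{k\in A}$ with $x_k|_{k\wedge l}=x_l|_{k\wedge l}$ for all $k,l\in A$ there is a unique $x\in P(\bigvee A)$ with $x|_k=x_k$ for all $k\in A$. $\mathbf{SHV}(H)$ is the full subcategory of sheaves in $\mathbf{Set}^{H^{op}}$. Let $PT_{\inf}(H)$ have sets as objects and, as morphisms $\tau:A\to B$, families of relations $\tau_h\subseteq B\times A$ ($h\in H$) such that for all $a\in A$, $b\in B$ the set $\{h\mid \tau_h(b,a)\}$ is of the form $\{h\mid h\le m\}$. The composite of $\tau:A\to B$ and $\sigma:B\to C$ is given by: $(\sigma\tau)_h(c,a)$ iff there is a (possibly empty) family $\langle k_i,l_i\rangle_{i\in I}$ in $H$ with $h\le\bigvee_i(k_i\wedge l_i)$ and, for every $i$, some $b\in B$ with $\sigma_{k_i}(c,b)$ and $\tau_{l_i}(b,a)$. Morphisms are ordered by inclusion of all relations, and the involution $\tau^*$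 takes the inverse of each relation. For an involutive order-enriched semicategory $\mathcal O$, $\mathbf{Kar}^*(\mathcal O)$ is the category whose objects are the symmetric idempotents ($f^*=f=ff$) of $\mathcal O$ and whose morphisms $f\to g$ are the arrows $\varphi$ with $\varphi f=\varphi=g\varphi$, the identity of $f$ being $f$ itself. For an involutive order-enriched category $\mathcal C$, $\mathbf{Map}^*(\mathcal C)$ has the same objects, and the morphisms $f:A\to B$ with $1_A\le f^*f$ and $ff^*\le 1_B$. The category of relational-sheaves of $H$ is $\mathbf{Rel}^{H^{co}}_{\inf}=\mathbf{Map}^*(\mathbf{Kar}^*(PT_{\inf}(H)))$. For a relational-sheaf $F$ write $F(*)$ for its underlying set and $F(h)$ for its relations. For $h\in H$ let $F_h$ be the relational-sheaf on a one-point set $\{*\}$ with $F_h(k)(*,*)$ iff $k\le h$; for $k\le h$ let $F_k\to F_h$ be the morphism whose $l$-th relation holds iff $l\le k$. Define $\Theta_{\inf}:\mathbf{Rel}^{H^{co}}_{\inf}\to\mathbf{Set}^{H^{op}}$ by letting $\Theta_{\inf}(F)(h)$ be the set of morphisms $F_h\to F$, with restriction given by precomposition with $F_k\to F_h$, and letting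 $\Theta_{\inf}$ act on morphisms by postcomposition. Define $\Delta_{\inf}:\mathbf{Set}^{H^{op}}\to\mathbf{Rel}^{H^{co}}_{\inf}$ by $\Delta_{\inf}(P)(*)=\coprod_{h}P(h)$ and, for $b\in P(l)$, $a\in P(k)$, $$\Delta_{\inf}(P)(h)(b,a)\iff h\le\bigvee\{m\mid m\le k\wedge l,\ b|_m=a|_m\},$$ and, for $\tau:P\to Q$, $b\in Q(l)$, $a\in P(k)$, $$\Delta_{\inf}(\tau)_h(b,a)\iff h\le\bigvee\{m\mid m\le k\wedge l,\ b|_m=\tau_k(a)|_m\}.$$ Theorem. There is an adjunction $\Delta_{\inf}\dashv\Theta_{\inf}$ whose unit $\eta$ sends $x\in P(h)$ to the morphism $\alpha^x:F_h\to\Delta_{\inf}(P)$ with $\alpha^x_l(y,*)$ iff $\Delta_{\inf}(P)(l)(y,x)$. For every relational-sheaf $F$ the morphism $\eta_{\Theta_{\inf}(F)}$ is an isomorphism and $\Theta_{\inf}(F)$ is a sheaf. Moreover the restriction of $\Delta_{\inf}$ to sheaves and the corestriction of $\Theta_{\inf}$ to sheaves are the two functors of an equivalence of categories $$\mathbf{SHV}(H)\simeq\mathbf{Rel}^{H^{co}}_{\inf}.$$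 -/

import Mathlib

open CategoryTheory Opposite

universe u v

namespace RelSheaf

/-! ### Presheaves and sheaves on a complete Heyting algebra -/

section Sheaves

variable {H : Type u} [Order.Frame H]

/-- The restriction `x|_k` of a section `x ∈ P(h)` along `k ≤ h`. -/
def res (P : Hᵒᵖ ⥤ Type u) {k h : H} (hk : k ≤ h) (x : P.obj (op h)) : P.obj (op k) :=
  P.map (homOfLE hk).op x

/-- `⟨x_k⟩_{k ∈ A}` is a matching family for the subset `A`. -/
def IsMatchingFamily (P : Hᵒᵖ ⥤ Type u) (A : Set H) (x : ∀ k : A, P.obj (op (k : H))) : Prop :=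
  ∀ k l : A, res P (inf_le_left : (k : H) ⊓ l ≤ k) (x k) =
    res P (inf_le_right : (k : H) ⊓ l ≤ l) (x l)

/-- `y ∈ P(⋁ A)` is an amalgamation of the family `⟨x_k⟩_{k ∈ A}`. -/
def IsAmalgamation (P : Hᵒᵖ ⥤ Type u) (A : Set H) (x : ∀ k : A, P.obj (op (k : H)))
    (y : P.obj (op (sSup A))) : Prop :=
  ∀ k : A, res P (le_sSup k.2) y = x k

/-- A presheaf is a sheaf if every matching family has a unique amalgamation. -/
def IsSheaf : ObjectProperty (Hᵒᵖ ⥤ Type u) := fun P =>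
  ∀ (A : Set H) (x : ∀ k : A, P.obj (op (k : H))), IsMatchingFamily P A x →
    ∃! y : P.obj (op (sSup A)), IsAmalgamation P A x y

variable (H) in
/-- The full subcategory of sheaves in the category of presheaves on `H`. -/
abbrev SHV := (IsSheaf (H := H)).FullSubcategory

end Sheaves

/-! ### Involutive order-enriched (semi)categories, `Kar*` and `Map*` -/

/-- Involutive order-enriched semicategories. Composition is written in diagrammatic order:
`comp f g` is `g ∘ f`. -/
class InvOrdSemicategory (O : Type u) where
  Hom : O → O → Type v
  order : ∀ A B : O, PartialOrder (Hom A B)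
  comp : ∀ {A B C : O}, Hom A B → Hom B C → Hom A C
  star : ∀ {A B : O}, Hom A B → Hom B A
  assoc : ∀ {A B C D : O} (f : Hom A B) (g : Hom B C) (h : Hom C D),
    comp (comp f g) h = comp f (comp g h)
  comp_le_comp : ∀ {A B C : O} {f f' : Hom A B} {g g' : Hom B C},
    f ≤ f' → g ≤ g' → comp f g ≤ comp f' g'
  star_star : ∀ {A B : O} (f : Hom A B), star (star f) = f
  star_comp : ∀ {A B C : O} (f : Hom A B) (g : Hom B C),
    star (comp f g) = comp (star g) (star f)
  star_le_star : ∀ {A B : O} {f f' : Hom A B}, f ≤ f' → star f ≤ star f'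

attribute [reducible, instance] InvOrdSemicategory.order

/-- Involutive order-enriched categories. -/
class InvOrdCategory (C : Type u) [Category.{v} C] where
  order : ∀ A B : C, PartialOrder (A ⟶ B)
  star : ∀ {A B : C}, (A ⟶ B) → (B ⟶ A)
  comp_le_comp : ∀ {X Y Z : C} {f f' : X ⟶ Y} {g g' : Y ⟶ Z},
    f ≤ f' → g ≤ g' → f ≫ g ≤ f' ≫ g'
  star_star : ∀ {A B : C} (f : A ⟶ B), star (star f) = f
  star_id : ∀ A : C, star (𝟙 A) = 𝟙 A
  star_comp : ∀ {X Y Z : C} (f : X ⟶ Y) (g : Y ⟶ Z), star (f ≫ g) = star g ≫ star f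
  star_le_star : ∀ {A B : C} {f f' : A ⟶ B}, f ≤ f' → star f ≤ star f'

attribute [reducible, instance] InvOrdCategory.order

section Kar

open InvOrdSemicategory

variable (O : Type u) [InvOrdSemicategory.{u, v} O]

/-- Objects of the symmetric Karoubian envelope: symmetric idempotents. -/
structure KarStar where
  pt : O
  arr : Hom pt pt
  symm : star arr = arr
  idem : comp arr arr = arr

variable {O}

/-- Morphisms `φ : f → g` of the symmetric Karoubian envelope: `φ ∘ f = φ = g ∘ φ`. -/
@[ext]
structure KarStar.Mor (f g : KarStar O) where
  arr : Hom f.pt g.pt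
  left : comp f.arr arr = arr
  right : comp arr g.arr = arr

instance : Category.{v} (KarStar O) where
  Hom f g := KarStar.Mor f g
  id f := ⟨f.arr, f.idem, f.idem⟩
  comp φ ψ := ⟨comp φ.arr ψ.arr, by rw [← assoc, φ.left], by rw [assoc, ψ.right]⟩
  id_comp φ := KarStar.Mor.ext φ.left
  comp_id φ := KarStar.Mor.ext φ.right
  assoc φ ψ χ := KarStar.Mor.ext (assoc φ.arr ψ.arr χ.arr)

instance : InvOrdCategory (KarStar O) where
  order f g := PartialOrder.lift (fun φ : KarStar.Mor f g => φ.arr)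
    (fun _ _ h => KarStar.Mor.ext h)
  star {f g} φ := ⟨star φ.arr,
    by have h := congrArg InvOrdSemicategory.star φ.right; rwa [star_comp, g.symm] at h,
    by have h := congrArg InvOrdSemicategory.star φ.left; rwa [star_comp, f.symm] at h⟩
  comp_le_comp h h' := InvOrdSemicategory.comp_le_comp h h'
  star_star φ := KarStar.Mor.ext (star_star φ.arr)
  star_id f := KarStar.Mor.ext f.symm
  star_comp φ ψ := KarStar.Mor.ext (star_comp φ.arr ψ.arr)
  star_le_star h := InvOrdSemicategory.star_le_star h

end Kar

section Map

open InvOrdCategory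

variable (C : Type u) [Category.{v} C] [InvOrdCategory C]

/-- Symmetric maps: `1 ≤ f* ∘ f` and `f ∘ f* ≤ 1`. -/
def symmetricMaps : MorphismProperty C := fun A B f =>
  𝟙 A ≤ f ≫ star f ∧ star f ≫ f ≤ 𝟙 B

instance : (symmetricMaps C).IsMultiplicative where
  id_mem A := by
    constructor <;> simp [star_id]
  comp_mem {X Y Z} f g hf hg := by
    constructor
    · calc 𝟙 X ≤ f ≫ star f := hf.1
        _ = (f ≫ 𝟙 Y) ≫ star f := by rw [Category.comp_id]
        _ ≤ (f ≫ (g ≫ star g)) ≫ star f :=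
          comp_le_comp (comp_le_comp le_rfl hg.1) le_rfl
        _ = (f ≫ g) ≫ star (f ≫ g) := by rw [star_comp]; simp only [Category.assoc]
    · calc star (f ≫ g) ≫ f ≫ g = (star g ≫ (star f ≫ f)) ≫ g := by
            rw [star_comp]; simp only [Category.assoc]
        _ ≤ (star g ≫ 𝟙 Y) ≫ g := comp_le_comp (comp_le_comp le_rfl hf.2) le_rfl
        _ = star g ≫ g := by rw [Category.comp_id]
        _ ≤ 𝟙 Z := hg.2

/-- The category with all objects of `C` and the symmetric maps as morphisms. -/
abbrev MapStar := WideSubcategory (symmetricMaps C)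

end Map

/-! ### Infima-preserving pre-transformations -/

section PT

variable (H : Type u) [Order.Frame H]

/-- Objects of the semicategory of infima-preserving pre-transformations: sets. -/
structure PTinf (H : Type u) where
  carrier : Type u

variable {H}

/-- An infima-preserving pre-transformation `A → B`: a family of relations `rel h ⊆ B × A` such
that every set `{h | rel h b a}` is a principal down-closed subset of `H`. -/
@[ext]
structure PreTrans (H : Type u) [Order.Frame H] (A B : Type u) where
  rel : H → B → A → Prop
  principal : ∀ b a, ∃ m : H, {h | rel h b a} = Set.Iic m

namespace PreTrans

variable {A B C D : Type u}

/-- The generator of the principal down-closed set `{h | rel h b a}`. -/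
def val (τ : PreTrans H A B) (b : B) (a : A) : H := sSup {h | τ.rel h b a}

theorem rel_iff (τ : PreTrans H A B) (h : H) (b : B) (a : A) :
    τ.rel h b a ↔ h ≤ τ.val b a := by
  obtain ⟨m, hm⟩ := τ.principal b a
  have h1 : τ.val b a = m := by rw [val, hm]; exact csSup_Iic
  rw [h1]
  exact Set.ext_iff.1 hm h

theorem ext_val {σ τ : PreTrans H A B} (h : ∀ b a, σ.val b a = τ.val b a) : σ = τ := by
  ext k b a
  rw [rel_iff, rel_iff, h]

/-- The pre-transformation of a matrix with entries in `H`. -/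
def ofMatrix (M : B → A → H) : PreTrans H A B where
  rel h b a := h ≤ M b a
  principal b a := ⟨M b a, rfl⟩

@[simp]
theorem val_ofMatrix (M : B → A → H) (b : B) (a : A) :
    (ofMatrix M : PreTrans H A B).val b a = M b a :=
  csSup_Iic

/-- The relation of the composite `σ ∘ τ` of infima-preserving pre-transformations. -/
def compRel (τ : PreTrans H A B) (σ : PreTrans H B C) (h : H) (c : C) (a : A) : Prop :=
  ∃ (I : Type u) (k l : I → H), h ≤ ⨆ i, k i ⊓ l i ∧
    ∀ i, ∃ b, σ.rel (k i) c b ∧ τ.rel (l i) b a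

theorem compRel_iff (τ : PreTrans H A B) (σ : PreTrans H B C) (h : H) (c : C) (a : A) :
    compRel τ σ h c a ↔ h ≤ ⨆ b, σ.val c b ⊓ τ.val b a := by
  constructor
  · rintro ⟨I, k, l, hh, hi⟩
    refine hh.trans (iSup_le fun i => ?_)
    obtain ⟨b, h1, h2⟩ := hi i
    exact (inf_le_inf ((rel_iff _ _ _ _).1 h1) ((rel_iff _ _ _ _).1 h2)).trans
      (le_iSup (fun b => σ.val c b ⊓ τ.val b a) b)
  · intro hh
    exact ⟨B, fun b => σ.val c b, fun b => τ.val b a, hh,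
      fun b => ⟨b, (rel_iff _ _ _ _).2 le_rfl, (rel_iff _ _ _ _).2 le_rfl⟩⟩

/-- The composite `σ ∘ τ`. -/
def comp (τ : PreTrans H A B) (σ : PreTrans H B C) : PreTrans H A C where
  rel := compRel τ σ
  principal c a := ⟨⨆ b, σ.val c b ⊓ τ.val b a, Set.ext fun h => compRel_iff τ σ h c a⟩

@[simp]
theorem val_comp (τ : PreTrans H A B) (σ : PreTrans H B C) (c : C) (a : A) :
    (τ.comp σ).val c a = ⨆ b, σ.val c b ⊓ τ.val b a := by
  refine eq_of_forall_le_iff fun h => ?_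
  rw [← rel_iff, ← compRel_iff]
  rfl

/-- The involution takes the inverse of every relation of the family. -/
def star (τ : PreTrans H A B) : PreTrans H B A where
  rel h a b := τ.rel h b a
  principal a b := τ.principal b a

@[simp]
theorem val_star (τ : PreTrans H A B) (b : B) (a : A) : τ.star.val a b = τ.val b a := rfl

instance : PartialOrder (PreTrans H A B) :=
  PartialOrder.lift PreTrans.rel fun _ _ h => PreTrans.ext h

theorem le_iff_val {σ τ : PreTrans H A B} : σ ≤ τ ↔ ∀ b a, σ.val b a ≤ τ.val b a := by
  constructor
  · intro h b a
    exact (rel_iff _ _ _ _).1 (h _ _ _ ((rel_iff _ _ _ _).2 le_rfl))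
  · intro h k b a hk
    exact (rel_iff _ _ _ _).2 (((rel_iff _ _ _ _).1 hk).trans (h b a))

theorem comp_assoc (τ : PreTrans H A B) (σ : PreTrans H B C) (ρ : PreTrans H C D) :
    (τ.comp σ).comp ρ = τ.comp (σ.comp ρ) := by
  refine ext_val fun d a => ?_
  simp only [val_comp, inf_iSup_eq, iSup_inf_eq]
  rw [iSup_comm]
  simp only [inf_assoc]

end PreTrans

instance : InvOrdSemicategory.{u + 1, u} (PTinf H) where
  Hom A B := PreTrans H A.carrier B.carrier
  order _ _ := inferInstance
  comp τ σ := τ.comp σ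
  star τ := τ.star
  assoc := PreTrans.comp_assoc
  comp_le_comp := by
    intro A B C f f' g g' hf hg
    rw [PreTrans.le_iff_val] at *
    intro c a
    simp only [PreTrans.val_comp]
    exact iSup_mono fun b => inf_le_inf (hg c b) (hf b a)
  star_star _ := rfl
  star_comp f g := by
    refine PreTrans.ext_val fun a c => ?_
    simp only [PreTrans.val_star, PreTrans.val_comp]
    exact iSup_congr fun b => inf_comm _ _
  star_le_star := fun h k a b => h k b a

variable (H) in
/-- The category of relational-sheaves of `H`: `Map*(Kar*(PT_inf(H)))`. -/
abbrev RelInf := MapStar (KarStar (PTinf H))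

end PT

/-! ### Relational-sheaves in components -/

section RelInf

variable {H : Type u} [Order.Frame H]

namespace RelInf

/-- The underlying set `F(*)` of a relational-sheaf. -/
def set (F : RelInf H) : Type u := F.obj.pt.carrier

/-- The family of relations `F(h)` of a relational-sheaf. -/
def fam (F : RelInf H) : PreTrans H F.set F.set := F.obj.arr

/-- The family of relations `τ_h` of a morphism of relational-sheaves. -/
def tr {F G : RelInf H} (τ : F ⟶ G) : PreTrans H F.set G.set := τ.hom.arr

theorem hom_ext {F G : RelInf H} {σ τ : F ⟶ G} (h : tr σ = tr τ) : σ = τ :=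
  WideSubcategory.hom_ext _ (KarStar.Mor.ext h)

/-- A relational-sheaf from a symmetric idempotent infima-preserving pre-transformation. -/
def mk (A : Type u) (τ : PreTrans H A A) (symm : τ.star = τ) (idem : τ.comp τ = τ) : RelInf H :=
  ⟨⟨⟨A⟩, τ, symm, idem⟩⟩

/-- A morphism of relational-sheaves from a pre-transformation with the required properties. -/
def homMk {F G : RelInf H} (τ : PreTrans H F.set G.set) (left : F.fam.comp τ = τ)
    (right : τ.comp G.fam = τ) (total : F.fam ≤ τ.comp τ.star)
    (single : τ.star.comp τ ≤ G.fam) : F ⟶ G :=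
  ⟨⟨τ, left, right⟩, total, single⟩

end RelInf

/-! ### The functor `Θ_inf` -/

/-- The pre-transformation on the one-point set whose `l`-th relation holds iff `l ≤ k`. -/
def singleArr (k : H) : PreTrans H PUnit PUnit := PreTrans.ofMatrix fun _ _ => k

theorem singleArr_comp (k l : H) : (singleArr k).comp (singleArr l) = singleArr (l ⊓ k) :=
  PreTrans.ext_val fun _ _ => by simp [singleArr]

theorem singleArr_le {k l : H} (h : k ≤ l) : singleArr k ≤ singleArr l :=
  PreTrans.le_iff_val.2 fun _ _ => by simpa [singleArr] using h

/-- The singleton relational-sheaf `F_h`: one point, with `F_h(k)(*,*) = 1` iff `k ≤ h`. -/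
def single (h : H) : RelInf H :=
  RelInf.mk PUnit (singleArr h) rfl (by rw [singleArr_comp, inf_idem])

/-- For `k ≤ h` the singleton morphism `F_k → F_h` with `l`-th relation holding iff `l ≤ k`. -/
def singleMap {k h : H} (hk : k ≤ h) : single k ⟶ single h :=
  RelInf.homMk (F := single k) (G := single h) (singleArr k)
    ((singleArr_comp k k).trans (by rw [inf_idem]))
    ((singleArr_comp k h).trans (by rw [inf_eq_right.2 hk]))
    (le_of_le_of_eq (singleArr_le (le_inf le_rfl le_rfl)) (singleArr_comp k k).symm)
    (le_of_eq_of_le (singleArr_comp k k) (singleArr_le (inf_le_left.trans hk)))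

theorem singleMap_refl (h : H) : singleMap (le_refl h) = 𝟙 (single h) := rfl

theorem singleMap_comp {k l h : H} (hk : k ≤ l) (hl : l ≤ h) :
    singleMap hk ≫ singleMap hl = singleMap (hk.trans hl) :=
  RelInf.hom_ext ((singleArr_comp k l).trans (by rw [inf_eq_right.2 hk]; rfl))

/-- The presheaf `Θ_inf(F)` of singleton morphisms `F_h → F`, with restriction along `k ≤ h`
given by precomposition with `F_k → F_h`. -/
def ThetaObj (F : RelInf H) : Hᵒᵖ ⥤ Type u where
  obj h := single h.unop ⟶ F
  map f := TypeCat.ofHom fun α => singleMap (leOfHom f.unop) ≫ α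
  map_id h := by
    refine ConcreteCategory.hom_ext _ _ fun α => ?_
    exact Category.id_comp α
  map_comp f g := by
    refine ConcreteCategory.hom_ext _ _ fun α => ?_
    change singleMap _ ≫ α = singleMap _ ≫ singleMap _ ≫ α
    rw [← Category.assoc, singleMap_comp]

variable (H) in
/-- `Θ_inf`, acting on morphisms by postcomposition. -/
def Theta : RelInf H ⥤ (Hᵒᵖ ⥤ Type u) where
  obj := ThetaObj
  map τ :=
    { app := fun _ => TypeCat.ofHom fun α => α ≫ τ
      naturality := by
        intro _ _ f
        ext α
        exact (Category.assoc _ _ _) }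
  map_id F := by
    ext h α
    exact Category.comp_id α
  map_comp σ τ := by
    ext h α
    exact (Category.assoc _ _ _).symm

/-! ### The functor `Δ_inf` -/

/-- The supremum of all `m ≤ k ∧ l` such that `b ∈ P(l)` and `a ∈ P(k)` have the same restriction
to `m`. -/
def agree (P : Hᵒᵖ ⥤ Type u) (b a : Σ h : H, P.obj (op h)) : H :=
  sSup {m | ∃ (hb : m ≤ b.1) (ha : m ≤ a.1), res P hb b.2 = res P ha a.2}

/-- The action of a transformation of presheaves on `∐_h P(h)`. -/
def sigmaMap {P Q : Hᵒᵖ ⥤ Type u} (τ : P ⟶ Q) (a : Σ h : H, P.obj (op h)) :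
    Σ h : H, Q.obj (op h) :=
  ⟨a.1, τ.app (op a.1) a.2⟩

theorem res_res (P : Hᵒᵖ ⥤ Type u) {m k h : H} (hm : m ≤ k) (hk : k ≤ h) (x : P.obj (op h)) :
    res P hm (res P hk x) = res P (hm.trans hk) x := by
  simp only [res]
  rw [← Functor.map_comp_apply]
  rfl

theorem res_app {P Q : Hᵒᵖ ⥤ Type u} (τ : P ⟶ Q) {k h : H} (hk : k ≤ h) (x : P.obj (op h)) :
    res Q hk (τ.app (op h) x) = τ.app (op k) (res P hk x) :=
  (NatTrans.naturality_apply τ (homOfLE hk).op x).symm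

theorem agree_comm (P : Hᵒᵖ ⥤ Type u) (b a : Σ h : H, P.obj (op h)) :
    agree P b a = agree P a b := by
  unfold agree
  congr 1
  ext m
  exact ⟨fun ⟨hb, ha, h⟩ => ⟨ha, hb, h.symm⟩, fun ⟨hb, ha, h⟩ => ⟨ha, hb, h.symm⟩⟩

theorem agree_le_left (P : Hᵒᵖ ⥤ Type u) (b a : Σ h : H, P.obj (op h)) : agree P b a ≤ b.1 :=
  sSup_le fun _ ⟨hb, _, _⟩ => hb

theorem agree_self (P : Hᵒᵖ ⥤ Type u) (a : Σ h : H, P.obj (op h)) : agree P a a = a.1 :=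
  le_antisymm (agree_le_left P a a) (le_sSup ⟨le_rfl, le_rfl, rfl⟩)

theorem agree_trans (P : Hᵒᵖ ⥤ Type u) (c b a : Σ h : H, P.obj (op h)) :
    agree P c b ⊓ agree P b a ≤ agree P c a := by
  unfold agree
  rw [sSup_inf_sSup]
  refine iSup₂_le ?_
  rintro ⟨m, n⟩ ⟨⟨hc, hb, h1⟩, ⟨hb', ha, h2⟩⟩
  refine le_sSup ⟨inf_le_left.trans hc, inf_le_right.trans ha, ?_⟩
  have e1 := congrArg (res P (inf_le_left : m ⊓ n ≤ m)) h1
  have e2 := congrArg (res P (inf_le_right : m ⊓ n ≤ n)) h2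
  simp only [res_res] at e1 e2
  exact e1.trans e2

theorem agree_sigmaMap {P Q : Hᵒᵖ ⥤ Type u} (τ : P ⟶ Q) (b a : Σ h : H, P.obj (op h)) :
    agree P b a ≤ agree Q (sigmaMap τ b) (sigmaMap τ a) := by
  refine sSup_le_sSup ?_
  rintro m ⟨hb, ha, h⟩
  exact ⟨hb, ha, by simp only [sigmaMap, res_app]; rw [h]⟩

/-- The pre-transformation `∐_h P(h) → ∐_h Q(h)` of a transformation `τ : P → Q`: its `h`-th
relation holds at `(b, a)` iff `h` is below the supremum of all `m` on which the restrictions of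
`b` and `τ(a)` are defined and equal. -/
def deltaArr {P Q : Hᵒᵖ ⥤ Type u} (τ : P ⟶ Q) :
    PreTrans H (Σ h : H, P.obj (op h)) (Σ h : H, Q.obj (op h)) :=
  PreTrans.ofMatrix fun b a => agree Q b (sigmaMap τ a)

/-- The pre-transformation `h ≤ ⋁ {m | b|_m = a|_m}` on `∐_h P(h)`. -/
def deltaIdem (P : Hᵒᵖ ⥤ Type u) :
    PreTrans H (Σ h : H, P.obj (op h)) (Σ h : H, P.obj (op h)) :=
  PreTrans.ofMatrix (agree P)

theorem deltaArr_id (P : Hᵒᵖ ⥤ Type u) : deltaArr (𝟙 P) = deltaIdem P := rfl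

theorem deltaArr_comp {P Q R : Hᵒᵖ ⥤ Type u} (τ : P ⟶ Q) (σ : Q ⟶ R) :
    (deltaArr τ).comp (deltaArr σ) = deltaArr (τ ≫ σ) := by
  refine PreTrans.ext_val fun c a => ?_
  simp only [deltaArr, PreTrans.val_comp, PreTrans.val_ofMatrix]
  refine le_antisymm (iSup_le fun b => ?_) ?_
  · exact (inf_le_inf le_rfl (agree_sigmaMap σ _ _)).trans (agree_trans R _ _ _)
  · refine le_trans ?_ (le_iSup (fun b => agree R c (sigmaMap σ b) ⊓
      agree Q b (sigmaMap τ a)) (sigmaMap τ a))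
    refine le_inf le_rfl ?_
    rw [agree_self, agree_comm]
    exact agree_le_left R _ _

theorem deltaIdem_star (P : Hᵒᵖ ⥤ Type u) : (deltaIdem P).star = deltaIdem P :=
  PreTrans.ext_val fun a b => by simp [deltaIdem, agree_comm P a b]

theorem deltaIdem_comp (P : Hᵒᵖ ⥤ Type u) : (deltaIdem P).comp (deltaIdem P) = deltaIdem P := by
  rw [← deltaArr_id, deltaArr_comp, Category.comp_id]

theorem deltaIdem_le {P Q : Hᵒᵖ ⥤ Type u} (τ : P ⟶ Q) :
    deltaIdem P ≤ (deltaArr τ).comp (deltaArr τ).star := by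
  refine PreTrans.le_iff_val.2 fun c a => ?_
  simp only [deltaIdem, deltaArr, PreTrans.val_comp, PreTrans.val_ofMatrix, PreTrans.val_star]
  refine le_trans ?_ (le_iSup
    (fun b => agree Q b (sigmaMap τ c) ⊓ agree Q b (sigmaMap τ a)) (sigmaMap τ c))
  refine le_inf ?_ (agree_sigmaMap τ c a)
  rw [agree_self]
  exact agree_le_left P c a

theorem le_deltaIdem {P Q : Hᵒᵖ ⥤ Type u} (τ : P ⟶ Q) :
    (deltaArr τ).star.comp (deltaArr τ) ≤ deltaIdem Q := by
  refine PreTrans.le_iff_val.2 fun c a => ?_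
  simp only [deltaIdem, deltaArr, PreTrans.val_comp, PreTrans.val_ofMatrix, PreTrans.val_star]
  refine iSup_le fun b => ?_
  rw [agree_comm Q a]
  exact agree_trans Q _ _ _

/-- The relational-sheaf `Δ_inf(P)` on the set `∐_h P(h)`. -/
def DeltaObj (P : Hᵒᵖ ⥤ Type u) : RelInf H :=
  RelInf.mk (Σ h : H, P.obj (op h)) (deltaIdem P) (deltaIdem_star P) (deltaIdem_comp P)

variable (H) in
/-- `Δ_inf`. -/
def Delta : (Hᵒᵖ ⥤ Type u) ⥤ RelInf H where
  obj := DeltaObj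
  map {P Q} τ := RelInf.homMk (F := DeltaObj P) (G := DeltaObj Q) (deltaArr τ)
    ((deltaArr_comp (𝟙 P) τ).trans (by rw [Category.id_comp]))
    ((deltaArr_comp τ (𝟙 Q)).trans (by rw [Category.comp_id]))
    (deltaIdem_le τ) (le_deltaIdem τ)
  map_id P := RelInf.hom_ext (deltaArr_id P)
  map_comp τ σ := RelInf.hom_ext (deltaArr_comp τ σ).symm

end RelInf

end RelSheaf


namespace RelSheaf

/-!
A relational-sheaf `F` is a set with an `H`-valued equality, a morphism `F ⟶ G` is a matrix with
entries in `H` that is the graph of a function in the internal logic, and a section of `Θ(F)` over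
`h` is a vector `v : F → H` that internally is a singleton of extent `h`. Every `a ∈ F` represents
the singleton `b ↦ F(b, a)`, and `η` sends `x ∈ P(h)` to the singleton of `Δ(P)` it represents.
The counit `Δ(Θ(F)) ⟶ F` has the entry `v(a)` at `(a, v)`.

A singleton `v` coincides over `v(a)` with the one represented by `a`. Hence two singletons `v`, `w`
agree exactly on `⋁ₐ v(a) ∧ w(a)`, which makes the counit internally bijective and so invertible;
and every section of `Θ(Δ(P))` is locally in the image of `η`, so that `η` is invertible when `P` is
a sheaf. Singletons glue by taking suprema, so `Θ(F)` is always a sheaf.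
-/

open InvOrdCategory in
theorem MapStar.isIso_of_star {C : Type u} [Category.{v} C] [InvOrdCategory C] {A B : MapStar C}
    (f : A ⟶ B) (mono : f.hom ≫ star f.hom ≤ 𝟙 A.obj) (epi : 𝟙 B.obj ≤ star f.hom ≫ f.hom) :
    IsIso f := by
  have star_mem : symmetricMaps C (star f.hom) := by
    rw [symmetricMaps, InvOrdCategory.star_star]
    exact ⟨epi, mono⟩
  exact ⟨⟨star f.hom, star_mem⟩, WideSubcategory.hom_ext _ (mono.antisymm f.property.1),
    WideSubcategory.hom_ext _ (f.property.2.antisymm epi)⟩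

variable {H : Type u} [Order.Frame H]

namespace RelInf

variable {F G K : RelInf H}

/-- The `H`-valued equality of a relational-sheaf: `eqVal F b a` is the largest `h` such that
`F(h)(b, a)`. -/
def eqVal (F : RelInf H) (b a : F.set) : H := F.fam.val b a

/-- The entries of a morphism of relational-sheaves: `homVal τ b a` is the largest `h` such that
`τ_h(b, a)`. -/
def homVal (τ : F ⟶ G) (b : G.set) (a : F.set) : H := (tr τ).val b a

theorem hom_ext_homVal {σ τ : F ⟶ G} (h : ∀ b a, homVal σ b a = homVal τ b a) : σ = τ :=
  hom_ext (PreTrans.ext_val h)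

theorem homVal_id (b a : F.set) : homVal (𝟙 F) b a = F.eqVal b a := rfl

theorem homVal_comp (τ : F ⟶ G) (σ : G ⟶ K) (c : K.set) (a : F.set) :
    homVal (τ ≫ σ) c a = ⨆ b, homVal σ c b ⊓ homVal τ b a :=
  PreTrans.val_comp (tr τ) (tr σ) c a

theorem eqVal_comm (b a : F.set) : F.eqVal b a = F.eqVal a b :=
  congrArg (fun τ : PreTrans H F.set F.set => τ.val a b) F.obj.symm

theorem iSup_homVal_inf_eqVal (τ : F ⟶ G) (b : G.set) (a : F.set) :
    ⨆ a', homVal τ b a' ⊓ F.eqVal a' a = homVal τ b a := by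
  simpa only [homVal_comp, homVal_id] using congrArg (homVal · b a) (Category.id_comp τ)

theorem iSup_eqVal_inf_homVal (τ : F ⟶ G) (b : G.set) (a : F.set) :
    ⨆ b', G.eqVal b b' ⊓ homVal τ b' a = homVal τ b a := by
  simpa only [homVal_comp, homVal_id] using congrArg (homVal · b a) (Category.comp_id τ)

theorem eqVal_trans (c b a : F.set) : F.eqVal c b ⊓ F.eqVal b a ≤ F.eqVal c a :=
  (le_iSup (fun b => F.eqVal c b ⊓ F.eqVal b a) b).trans_eq (iSup_homVal_inf_eqVal (𝟙 F) c a)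

theorem eqVal_le_self_right (b a : F.set) : F.eqVal b a ≤ F.eqVal a a :=
  (le_inf (eqVal_comm b a).le le_rfl).trans (eqVal_trans a b a)

/-- The matrices that define a morphism `F ⟶ G`: in the internal logic of `H`, `M b a` is the graph
`b = f a` of a function `f : F → G`. -/
structure IsFunctional (F G : RelInf H) (M : G.set → F.set → H) : Prop where
  inf_eqVal_le : ∀ b a' a, M b a' ⊓ F.eqVal a' a ≤ M b a
  eqVal_inf_le : ∀ b b' a, G.eqVal b b' ⊓ M b' a ≤ M b a
  le_eqVal : ∀ b a, M b a ≤ F.eqVal a a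
  total : ∀ a, F.eqVal a a ≤ ⨆ b, M b a
  single_valued : ∀ b b' a, M b a ⊓ M b' a ≤ G.eqVal b b'

theorem isFunctional_homVal (τ : F ⟶ G) : IsFunctional F G (homVal τ) where
  inf_eqVal_le b a' a :=
    (le_iSup (fun a' => homVal τ b a' ⊓ F.eqVal a' a) a').trans_eq (iSup_homVal_inf_eqVal τ b a)
  eqVal_inf_le b b' a :=
    (le_iSup (fun b' => G.eqVal b b' ⊓ homVal τ b' a) b').trans_eq (iSup_eqVal_inf_homVal τ b a)
  le_eqVal b a := by
    rw [← iSup_homVal_inf_eqVal τ b a]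
    exact iSup_le fun a' => inf_le_right.trans (eqVal_le_self_right a' a)
  total a := by
    have total : F.fam ≤ (tr τ).comp (tr τ).star := τ.property.1
    refine (PreTrans.le_iff_val.1 total a a).trans ?_
    rw [PreTrans.val_comp]
    exact iSup_mono fun b => inf_le_right
  single_valued b b' a := by
    have single : (tr τ).star.comp (tr τ) ≤ G.fam := τ.property.2
    refine le_trans ?_ (PreTrans.le_iff_val.1 single b b')
    rw [PreTrans.val_comp]
    exact le_iSup (fun a => homVal τ b a ⊓ homVal τ b' a) a

/-- The morphism of relational-sheaves with the entries `M`. -/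
def ofFunctional (M : G.set → F.set → H) (hM : IsFunctional F G M) : F ⟶ G :=
  homMk (PreTrans.ofMatrix M)
    (PreTrans.ext_val fun b a => by
      simp only [PreTrans.val_comp, PreTrans.val_ofMatrix]
      exact le_antisymm (iSup_le fun a' => hM.inf_eqVal_le b a' a)
        (le_iSup_of_le a (le_inf le_rfl (hM.le_eqVal b a))))
    (PreTrans.ext_val fun b a => by
      simp only [PreTrans.val_comp, PreTrans.val_ofMatrix]
      exact le_antisymm (iSup_le fun b' => hM.eqVal_inf_le b b' a)
        (le_iSup_of_le b (le_inf (inf_idem (M b a) ▸ hM.single_valued b b a) le_rfl)))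
    (PreTrans.le_iff_val.2 fun a' a => by
      simp only [PreTrans.val_comp, PreTrans.val_ofMatrix, PreTrans.val_star]
      calc F.eqVal a' a ≤ (⨆ b, M b a) ⊓ F.eqVal a a' :=
            le_inf ((eqVal_le_self_right a' a).trans (hM.total a)) (eqVal_comm a' a).le
        _ = ⨆ b, M b a ⊓ F.eqVal a a' := iSup_inf_eq _ _
        _ ≤ ⨆ b, M b a' ⊓ M b a :=
            iSup_mono fun b => le_inf (hM.inf_eqVal_le b a a') inf_le_left)
    (PreTrans.le_iff_val.2 fun b b' => by
      simp only [PreTrans.val_comp, PreTrans.val_ofMatrix, PreTrans.val_star]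
      exact iSup_le fun a => hM.single_valued b b' a)

@[simp]
theorem homVal_ofFunctional (M : G.set → F.set → H) (hM : IsFunctional F G M) (b : G.set)
    (a : F.set) : homVal (ofFunctional M hM) b a = M b a :=
  PreTrans.val_ofMatrix M b a

theorem isIso_of_injective_of_surjective (τ : F ⟶ G)
    (inj : ∀ b a a', homVal τ b a ⊓ homVal τ b a' ≤ F.eqVal a a')
    (surj : ∀ b, G.eqVal b b ≤ ⨆ a, homVal τ b a) : IsIso τ := by
  have mono : (tr τ).comp (tr τ).star ≤ F.fam := PreTrans.le_iff_val.2 fun a a' => by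
    simp only [PreTrans.val_comp, PreTrans.val_star]
    exact iSup_le fun b => inj b a a'
  have epi : G.fam ≤ (tr τ).star.comp (tr τ) := PreTrans.le_iff_val.2 fun b' b => by
    simp only [PreTrans.val_comp, PreTrans.val_star]
    calc G.eqVal b' b ≤ G.eqVal b' b ⊓ ⨆ a, homVal τ b a :=
          le_inf le_rfl ((eqVal_le_self_right b' b).trans (surj b))
      _ = ⨆ a, G.eqVal b' b ⊓ homVal τ b a := inf_iSup_eq _ _
      _ ≤ ⨆ a, homVal τ b' a ⊓ homVal τ b a :=
          iSup_mono fun a => le_inf ((isFunctional_homVal τ).eqVal_inf_le b' b a) inf_le_right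
  exact MapStar.isIso_of_star τ mono epi

/-- The vectors that define a morphism `F_h ⟶ F`: in the internal logic of `H`, `v` is a subset of
`F` with at most one element, and `h` is the truth value of its being inhabited. -/
structure IsSingleton (F : RelInf H) (h : H) (v : F.set → H) : Prop where
  eqVal_inf_le : ∀ a b, F.eqVal a b ⊓ v b ≤ v a
  inf_le_eqVal : ∀ a b, v a ⊓ v b ≤ F.eqVal a b
  iSup_eq : ⨆ a, v a = h

namespace IsSingleton

variable {h : H} {v : F.set → H}

theorem le (hv : IsSingleton F h v) (a : F.set) : v a ≤ h :=
  (le_iSup v a).trans_eq hv.iSup_eq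

theorem le_eqVal (hv : IsSingleton F h v) (a : F.set) : v a ≤ F.eqVal a a :=
  inf_idem (v a) ▸ hv.inf_le_eqVal a a

theorem iSup {ι : Type*} {h : ι → H} {v : ι → F.set → H} (hv : ∀ i, IsSingleton F (h i) (v i))
    (compat : ∀ i j a, v i a ⊓ h j ≤ v j a) :
    IsSingleton F (⨆ i, h i) fun a => ⨆ i, v i a where
  eqVal_inf_le a b := by
    rw [inf_iSup_eq]
    exact iSup_mono fun i => (hv i).eqVal_inf_le a b
  inf_le_eqVal a b := by
    rw [iSup_inf_iSup]
    refine iSup_le fun ⟨i, j⟩ => ?_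
    calc v i a ⊓ v j b ≤ v j a ⊓ v j b :=
          le_inf ((inf_le_inf_left _ ((hv j).le b)).trans (compat i j a)) inf_le_right
      _ ≤ F.eqVal a b := (hv j).inf_le_eqVal a b
  iSup_eq := by
    rw [iSup_comm]
    exact iSup_congr fun i => (hv i).iSup_eq

end IsSingleton

theorem isSingleton_eqVal (a : F.set) : IsSingleton F (F.eqVal a a) fun b => F.eqVal b a where
  eqVal_inf_le b c := eqVal_trans b c a
  inf_le_eqVal b c := eqVal_comm c a ▸ eqVal_trans b a c
  iSup_eq := le_antisymm (iSup_le fun b => eqVal_le_self_right b a)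
    (le_iSup (fun b => F.eqVal b a) a)

theorem eqVal_single (h : H) (x y : (single h).set) : (single h).eqVal x y = h :=
  PreTrans.val_ofMatrix (A := PUnit) (B := PUnit) _ x y

theorem homVal_singleMap {k h : H} (hk : k ≤ h) (x : (single h).set) (y : (single k).set) :
    homVal (singleMap hk) x y = k :=
  PreTrans.val_ofMatrix (A := PUnit) (B := PUnit) _ x y

theorem isFunctional_single_iff {h : H} {v : F.set → H} :
    IsFunctional (single h) F (fun a _ => v a) ↔ IsSingleton F h v where
  mp hM :=
    { eqVal_inf_le a b := hM.eqVal_inf_le a b PUnit.unit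
      inf_le_eqVal a b := hM.single_valued a b PUnit.unit
      iSup_eq := le_antisymm
        (iSup_le fun a => (hM.le_eqVal a PUnit.unit).trans_eq (eqVal_single h _ _))
        ((eqVal_single h _ _).ge.trans (hM.total PUnit.unit)) }
  mpr hv :=
    { inf_eqVal_le _ _ _ := inf_le_left
      eqVal_inf_le a b _ := hv.eqVal_inf_le a b
      le_eqVal a _ := (hv.le a).trans_eq (eqVal_single h _ _).symm
      total _ := (eqVal_single h _ _).trans_le hv.iSup_eq.ge
      single_valued a b _ := hv.inf_le_eqVal a b }

end RelInf

open RelInf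

section Agree

variable (P : Hᵒᵖ ⥤ Type u)

/-- The set `∐_h P(h)` of all local sections of a presheaf. -/
abbrev Sections : Type u := Σ h : H, P.obj (op h)

variable {P} in
theorem le_agree {m : H} {b a : Sections P} (hb : m ≤ b.1) (ha : m ≤ a.1)
    (e : res P hb b.2 = res P ha a.2) : m ≤ agree P b a :=
  le_sSup ⟨hb, ha, e⟩

theorem agree_le_right (b a : Sections P) : agree P b a ≤ a.1 :=
  agree_comm P a b ▸ agree_le_left P a b

theorem agree_res_right {m h : H} (hm : m ≤ h) (x : P.obj (op h)) (y : Sections P) :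
    agree P y ⟨m, res P hm x⟩ = agree P y ⟨h, x⟩ ⊓ m := by
  have le_agree_res : m ≤ agree P ⟨m, res P hm x⟩ ⟨h, x⟩ := le_agree le_rfl hm (res_res ..)
  have le_right : agree P y ⟨m, res P hm x⟩ ≤ m := agree_le_right P y ⟨m, res P hm x⟩
  refine le_antisymm (le_inf ?_ le_right) ?_
  · exact (le_inf le_rfl (le_right.trans le_agree_res)).trans (agree_trans P _ _ _)
  · rw [agree_comm] at le_agree_res
    exact (inf_le_inf_left _ le_agree_res).trans (agree_trans P _ _ _)

/-- A presheaf is separated if sections that agree on a cover are equal. -/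
def IsSeparated : Prop :=
  ∀ ⦃h : H⦄ ⦃x y : P.obj (op h)⦄, h ≤ agree P ⟨h, x⟩ ⟨h, y⟩ → x = y

variable {P}

theorem IsSheaf.isSeparated (hP : IsSheaf P) : IsSeparated P := by
  intro h x y hxy
  obtain ⟨A, hA, eq_on⟩ : ∃ A : Set H, sSup A = h ∧
      ∀ m ∈ A, ∃ hx hy : m ≤ h, res P hx x = res P hy y :=
    ⟨_, (agree_le_left P ⟨h, x⟩ ⟨h, y⟩).antisymm hxy, fun _ hm => hm⟩
  subst hA
  refine (hP A (fun k => res P (le_sSup k.2) x) fun k l => ?_).unique (fun _ => rfl) fun k => ?_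
  · rw [res_res, res_res]
  · obtain ⟨_, _, e⟩ := eq_on k k.2
    exact e.symm

theorem isIso_of_injective_of_locally_surjective {Q : Hᵒᵖ ⥤ Type u} (hP : IsSheaf P)
    (hQ : IsSeparated Q) (f : P ⟶ Q) (inj : ∀ h : H, Function.Injective (f.app (op h)))
    (surj : ∀ (h : H) (s : Q.obj (op h)), ∃ A : Set H, sSup A = h ∧
      ∀ m ∈ A, ∃ (hm : m ≤ h) (x : P.obj (op m)), f.app (op m) x = res Q hm s) : IsIso f := by
  rw [NatTrans.isIso_iff_isIso_app]
  intro h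
  rw [isIso_iff_bijective]
  refine ⟨inj h.unop, fun s => ?_⟩
  obtain ⟨A, hA, lift⟩ := surj h.unop s
  obtain ⟨h⟩ := h
  subst hA
  choose hm x hx using fun k : A => lift k k.2
  have matching : IsMatchingFamily P A x := fun k l => inj _ (by
    rw [← res_app, ← res_app, hx, hx, res_res, res_res])
  obtain ⟨z, hz, -⟩ := hP A x matching
  refine ⟨z, hQ (sSup_le fun m hmA => le_agree (le_sSup hmA) (le_sSup hmA) ?_)⟩
  rw [res_app, hz ⟨m, hmA⟩]
  exact hx ⟨m, hmA⟩

end Agree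

namespace Theta

variable {F G : RelInf H} {h : H}

/-- The vector `F → H` of entries of a section of `Θ(F)` over `h`, that is, of a morphism
`F_h ⟶ F`. -/
def entry (s : ((Theta H).obj F).obj (op h)) (a : F.set) : H :=
  homVal (F := single h) s a PUnit.unit

/-- The section of `Θ(F)` over `h` with the entries `v`. -/
def ofSingleton (v : F.set → H) (hv : IsSingleton F h v) : ((Theta H).obj F).obj (op h) :=
  ofFunctional (F := single h) (fun a _ => v a) (isFunctional_single_iff.2 hv)

@[simp]
theorem entry_ofSingleton (v : F.set → H) (hv : IsSingleton F h v) (a : F.set) :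
    entry (ofSingleton v hv) a = v a :=
  homVal_ofFunctional ..

theorem isSingleton_entry (s : ((Theta H).obj F).obj (op h)) : IsSingleton F h (entry s) :=
  isFunctional_single_iff.1 (isFunctional_homVal (F := single h) s)

theorem entry_ext {s t : ((Theta H).obj F).obj (op h)} (e : ∀ a, entry s a = entry t a) : s = t :=
  hom_ext_homVal (F := single h) fun a _ => e a

theorem entry_map (τ : F ⟶ G) (s : ((Theta H).obj F).obj (op h)) (b : G.set) :
    entry (((Theta H).map τ).app (op h) s) b = ⨆ a, homVal τ b a ⊓ entry s a :=
  homVal_comp (F := single h) s τ b PUnit.unit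

theorem entry_res {k : H} (hk : k ≤ h) (s : ((Theta H).obj F).obj (op h)) (a : F.set) :
    entry (res ((Theta H).obj F) hk s) a = entry s a ⊓ k :=
  calc entry (res ((Theta H).obj F) hk s) a
      = ⨆ x, homVal (F := single h) s a x ⊓ homVal (singleMap hk) x PUnit.unit :=
        homVal_comp (singleMap hk) s a PUnit.unit
    _ = ⨆ _ : PUnit, entry s a ⊓ k :=
        iSup_congr fun x => congrArg (entry s a ⊓ ·) (homVal_singleMap hk x PUnit.unit)
    _ = entry s a ⊓ k := ciSup_const

/-- The section `b ↦ F(b, a)` of `Θ(F)` represented by `a`, over the extent `h = F(a, a)` of `a`.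
The extent is a parameter because for `F = Δ(P)` it equals the domain of definition of `a` only
propositionally. -/
def representable (a : F.set) (ha : F.eqVal a a = h) : ((Theta H).obj F).obj (op h) :=
  ofSingleton (fun b => F.eqVal b a) (ha ▸ isSingleton_eqVal a)

@[simp]
theorem entry_representable (a : F.set) (ha : F.eqVal a a = h) (b : F.set) :
    entry (representable a ha) b = F.eqVal b a :=
  entry_ofSingleton ..

theorem entry_map_representable (τ : F ⟶ G) (a : F.set) (ha : F.eqVal a a = h) (b : G.set) :
    entry (((Theta H).map τ).app (op h) (representable a ha)) b = homVal τ b a := by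
  simp only [entry_map, entry_representable, iSup_homVal_inf_eqVal]

theorem res_eq_res_representable (s : ((Theta H).obj F).obj (op h)) {a : F.set} {k m : H}
    (ha : F.eqVal a a = k) (hm : m ≤ entry s a) (hmh : m ≤ h) (hmk : m ≤ k) :
    res _ hmh s = res _ hmk (representable a ha) := by
  refine entry_ext fun b => ?_
  rw [entry_res, entry_res, entry_representable]
  have hs := isSingleton_entry s
  exact le_antisymm
    (le_inf ((inf_le_inf_left _ hm).trans (hs.inf_le_eqVal b a)) inf_le_right)
    (le_inf ((inf_le_inf_left _ hm).trans (hs.eqVal_inf_le b a)) inf_le_right)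

theorem agree_eq_iSup (s t : Sections ((Theta H).obj F)) :
    agree _ s t = ⨆ a, entry s.2 a ⊓ entry t.2 a := by
  obtain ⟨h, s⟩ := s
  obtain ⟨k, t⟩ := t
  have hs := isSingleton_entry s
  have ht := isSingleton_entry t
  refine le_antisymm (sSup_le ?_) (iSup_le fun a => ?_)
  · rintro m ⟨hm, hm', e⟩
    calc m = (⨆ a, entry s a) ⊓ m := by rw [hs.iSup_eq, inf_eq_right.2 hm]
      _ = ⨆ a, entry s a ⊓ m := iSup_inf_eq _ _
      _ ≤ ⨆ a, entry s a ⊓ entry t a := iSup_mono fun a => le_inf inf_le_left ?_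
    rw [← entry_res hm, e, entry_res]
    exact inf_le_left
  · exact le_agree (inf_le_left.trans (hs.le a)) (inf_le_right.trans (ht.le a))
      ((res_eq_res_representable s rfl inf_le_left _ (inf_le_left.trans (hs.le_eqVal a))).trans
        (res_eq_res_representable t rfl inf_le_right _ _).symm)

theorem isSheaf (F : RelInf H) : IsSheaf ((Theta H).obj F) := by
  intro A x hx
  have matching (k l : A) (a : F.set) : entry (x k) a ⊓ l = entry (x l) a ⊓ k := by
    have e := congrArg (entry · a) (hx k l)
    simp only [entry_res] at e
    rwa [← inf_assoc, inf_eq_left.2 ((isSingleton_entry (x k)).le a), inf_comm (k : H),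
      ← inf_assoc, inf_eq_left.2 ((isSingleton_entry (x l)).le a)] at e
  have glued : IsSingleton F (sSup A) fun a => ⨆ k : A, entry (x k) a :=
    sSup_eq_iSup' A ▸ IsSingleton.iSup (fun k => isSingleton_entry (x k))
      fun k l a => (matching k l a).trans_le inf_le_left
  refine ⟨ofSingleton _ glued, fun l => entry_ext fun a => ?_, fun t ht => entry_ext fun a => ?_⟩
  · rw [entry_res, entry_ofSingleton, iSup_inf_eq]
    refine le_antisymm (iSup_le fun k => (matching k l a).trans_le inf_le_left) ?_
    exact le_iSup_of_le l (le_inf le_rfl ((isSingleton_entry (x l)).le a))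
  · calc entry t a = entry t a ⊓ ⨆ k : A, (k : H) := by
          rw [← sSup_eq_iSup', inf_eq_left.2 ((isSingleton_entry t).le a)]
      _ = ⨆ k : A, entry t a ⊓ k := inf_iSup_eq _ _
      _ = ⨆ k : A, entry (x k) a := iSup_congr fun k => by rw [← ht k, entry_res]
      _ = entry (ofSingleton _ glued) a := (entry_ofSingleton _ glued a).symm

end Theta

open Theta

namespace Delta

variable (P : Hᵒᵖ ⥤ Type u) {Q : Hᵒᵖ ⥤ Type u} {F : RelInf H}

theorem eqVal_obj (b a : Sections P) : ((Delta H).obj P).eqVal b a = agree P b a :=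
  PreTrans.val_ofMatrix (agree P) b a

theorem eqVal_obj_self (a : Sections P) : ((Delta H).obj P).eqVal a a = a.1 :=
  (eqVal_obj P a a).trans (agree_self P a)

variable {P}

theorem homVal_map_comp (f : P ⟶ Q) (τ : (Delta H).obj Q ⟶ F) (b : F.set) (a : Sections P) :
    homVal ((Delta H).map f ≫ τ) b a = homVal τ b (sigmaMap f a) :=
  (homVal_comp (F := (Delta H).obj P) ((Delta H).map f) τ b a).trans
    (iSup_homVal_inf_eqVal τ b (sigmaMap f a))

theorem homVal_map (f : P ⟶ Q) (b : Sections Q) (a : Sections P) :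
    homVal ((Delta H).map f) b a = agree Q b (sigmaMap f a) :=
  PreTrans.val_ofMatrix (fun b a => agree Q b (sigmaMap f a)) b a

/-- The section of `Θ(Δ(P))` represented by a section `x` of `P`: the value of the unit at `x`. -/
def unitSection {h : H} (x : P.obj (op h)) : ((Theta H).obj ((Delta H).obj P)).obj (op h) :=
  representable (F := (Delta H).obj P) ⟨h, x⟩ (eqVal_obj_self P ⟨h, x⟩)

theorem entry_unitSection {h : H} (x : P.obj (op h)) (y : Sections P) :
    entry (unitSection x) y = agree P y ⟨h, x⟩ :=
  (entry_representable (F := (Delta H).obj P) _ _ y).trans (eqVal_obj P y ⟨h, x⟩)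

theorem res_unitSection {k h : H} (hk : k ≤ h) (x : P.obj (op h)) :
    res _ hk (unitSection x) = unitSection (res P hk x) :=
  entry_ext fun y =>
    calc entry (res _ hk (unitSection x)) y
        = entry (unitSection x) y ⊓ k := entry_res ..
      _ = agree P y ⟨h, x⟩ ⊓ k := congrArg (· ⊓ k) (entry_unitSection x y)
      _ = agree P y ⟨k, res P hk x⟩ := (agree_res_right P hk x y).symm
      _ = entry (unitSection (res P hk x)) y := (entry_unitSection _ y).symm

theorem entry_map_unitSection (τ : (Delta H).obj P ⟶ F) {h : H} (x : P.obj (op h)) (b : F.set) :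
    entry (((Theta H).map τ).app (op h) (unitSection x)) b = homVal τ b ⟨h, x⟩ :=
  entry_map_representable τ _ _ b

theorem map_unitSection (f : P ⟶ Q) {h : H} (x : P.obj (op h)) :
    ((Theta H).map ((Delta H).map f)).app (op h) (unitSection x) =
      unitSection (f.app (op h) x) :=
  entry_ext fun y =>
    calc entry (((Theta H).map ((Delta H).map f)).app (op h) (unitSection x)) y
        = homVal ((Delta H).map f) y ⟨h, x⟩ := entry_map_unitSection ..
      _ = agree Q y ⟨h, f.app (op h) x⟩ := homVal_map f y ⟨h, x⟩
      _ = entry (unitSection (f.app (op h) x)) y := (entry_unitSection _ y).symm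

end Delta

open Delta

/-- The unit of the adjunction `Δ ⊣ Θ`. -/
def unitApp (P : Hᵒᵖ ⥤ Type u) : P ⟶ (Theta H).obj ((Delta H).obj P) where
  app h := TypeCat.ofHom fun x => unitSection (h := h.unop) x
  naturality h k f := by
    ext x
    exact (res_unitSection (leOfHom f.unop) x).symm

theorem unitApp_apply (P : Hᵒᵖ ⥤ Type u) {h : H} (x : P.obj (op h)) :
    (unitApp P).app (op h) x = unitSection x := rfl

/-- The counit of the adjunction `Δ ⊣ Θ`, whose entry at `a ∈ F` and a section `s` of `Θ(F)` is
`s(a)`. -/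
def counitApp (F : RelInf H) : (Delta H).obj ((Theta H).obj F) ⟶ F :=
  ofFunctional (F := (Delta H).obj ((Theta H).obj F)) (fun a s => entry s.2 a) {
    inf_eqVal_le a t s := by
      calc entry t.2 a ⊓ ((Delta H).obj ((Theta H).obj F)).eqVal t s
          = entry t.2 a ⊓ ⨆ b, entry t.2 b ⊓ entry s.2 b :=
            congrArg (entry t.2 a ⊓ ·) ((eqVal_obj _ t s).trans (agree_eq_iSup t s))
        _ = ⨆ b, entry t.2 a ⊓ (entry t.2 b ⊓ entry s.2 b) := inf_iSup_eq _ _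
        _ ≤ entry s.2 a := iSup_le fun b => ?_
      rw [← inf_assoc]
      exact (inf_le_inf_right _ ((isSingleton_entry t.2).inf_le_eqVal a b)).trans
        ((isSingleton_entry s.2).eqVal_inf_le a b)
    eqVal_inf_le a b s := (isSingleton_entry s.2).eqVal_inf_le a b
    le_eqVal a s := ((isSingleton_entry s.2).le a).trans_eq (eqVal_obj_self _ s).symm
    total s := ((eqVal_obj_self _ s).trans (isSingleton_entry s.2).iSup_eq.symm).le
    single_valued a b s := (isSingleton_entry s.2).inf_le_eqVal a b }

theorem homVal_counitApp (F : RelInf H) (a : F.set) (s : Sections ((Theta H).obj F)) :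
    homVal (counitApp F) a s = entry s.2 a :=
  homVal_ofFunctional (F := (Delta H).obj ((Theta H).obj F)) _ _ a s

theorem map_counitApp_unitSection (F : RelInf H) {h : H} (s : ((Theta H).obj F).obj (op h)) :
    ((Theta H).map (counitApp F)).app (op h) (unitSection s) = s :=
  entry_ext fun a => by rw [entry_map_unitSection, homVal_counitApp]

theorem counitApp_naturality {F G : RelInf H} (τ : F ⟶ G) :
    (Delta H).map ((Theta H).map τ) ≫ counitApp G = counitApp F ≫ τ :=
  hom_ext_homVal fun b (s : Sections ((Theta H).obj F)) =>
    calc homVal ((Delta H).map ((Theta H).map τ) ≫ counitApp G) b s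
        = homVal (counitApp G) b (sigmaMap ((Theta H).map τ) s) := homVal_map_comp ..
      _ = entry (((Theta H).map τ).app (op s.1) s.2) b := homVal_counitApp ..
      _ = ⨆ a, homVal τ b a ⊓ entry s.2 a := entry_map τ s.2 b
      _ = ⨆ a, homVal τ b a ⊓ homVal (counitApp F) a s :=
        iSup_congr fun a => congrArg (homVal τ b a ⊓ ·) (homVal_counitApp F a s).symm
      _ = homVal (counitApp F ≫ τ) b s := (homVal_comp (counitApp F) τ b s).symm

theorem map_unitApp_comp_counitApp (P : Hᵒᵖ ⥤ Type u) :
    (Delta H).map (unitApp P) ≫ counitApp ((Delta H).obj P) = 𝟙 ((Delta H).obj P) :=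
  hom_ext_homVal fun (b a : Sections P) =>
    calc homVal ((Delta H).map (unitApp P) ≫ counitApp ((Delta H).obj P)) b a
        = homVal (counitApp ((Delta H).obj P)) b (sigmaMap (unitApp P) a) := homVal_map_comp ..
      _ = entry (unitSection a.2) b := homVal_counitApp ..
      _ = agree P b a := entry_unitSection a.2 b
      _ = homVal (𝟙 ((Delta H).obj P)) b a := (eqVal_obj P b a).symm

variable (H) in
/-- The adjunction `Δ ⊣ Θ`. -/
def deltaThetaAdj : Delta H ⊣ Theta H where
  unit :=
    { app := unitApp
      naturality P Q f := by
        ext h x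
        exact (map_unitSection f x).symm }
  counit :=
    { app := counitApp
      naturality _ _ τ := counitApp_naturality τ }
  left_triangle_components := map_unitApp_comp_counitApp
  right_triangle_components F := by
    ext h s
    exact map_counitApp_unitSection F s

theorem rel_tr_deltaThetaAdj_unit (P : Hᵒᵖ ⥤ Type u) {h : H} (x : P.obj (op h)) (l : H)
    (y : Sections P) :
    (tr (F := single h) (((deltaThetaAdj H).unit.app P).app (op h) x)).rel l y PUnit.unit ↔
      ((Delta H).obj P).fam.rel l y ⟨h, x⟩ := by
  have entry_eq : entry (unitSection x) y = ((Delta H).obj P).eqVal y ⟨h, x⟩ :=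
    (entry_unitSection x y).trans (eqVal_obj P y ⟨h, x⟩).symm
  calc _ ↔ l ≤ entry (unitSection x) y := PreTrans.rel_iff _ l y PUnit.unit
    _ ↔ l ≤ ((Delta H).obj P).eqVal y ⟨h, x⟩ := by rw [entry_eq]
    _ ↔ _ := (PreTrans.rel_iff ((Delta H).obj P).fam l y ⟨h, x⟩).symm

theorem isIso_counitApp (F : RelInf H) : IsIso (counitApp F) := by
  refine isIso_of_injective_of_surjective (F := (Delta H).obj ((Theta H).obj F)) _
    (fun a (s t : Sections ((Theta H).obj F)) => ?_) fun a => ?_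
  · rw [homVal_counitApp, homVal_counitApp]
    exact (le_iSup (fun a => entry s.2 a ⊓ entry t.2 a) a).trans_eq
      ((eqVal_obj _ s t).trans (agree_eq_iSup s t)).symm
  · refine le_iSup_of_le (ι := Sections ((Theta H).obj F)) ⟨_, representable a rfl⟩ ?_
    rw [homVal_counitApp, entry_representable]

theorem IsSeparated.injective_unitApp {P : Hᵒᵖ ⥤ Type u} (hP : IsSeparated P) (h : H) :
    Function.Injective ((unitApp P).app (op h)) := by
  intro x y e
  rw [unitApp_apply, unitApp_apply] at e
  refine hP ?_
  rw [← entry_unitSection, ← e, entry_unitSection, agree_self]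

theorem unitApp_locally_surjective (P : Hᵒᵖ ⥤ Type u) {h : H}
    (s : ((Theta H).obj ((Delta H).obj P)).obj (op h)) :
    ∃ A : Set H, sSup A = h ∧ ∀ m ∈ A, ∃ (hm : m ≤ h) (x : P.obj (op m)),
      (unitApp P).app (op m) x = res _ hm s := by
  have hs := isSingleton_entry s
  refine ⟨Set.range (entry s), hs.iSup_eq, ?_⟩
  rintro _ ⟨(y : Sections P), rfl⟩
  have hy : entry s y ≤ y.1 := (hs.le_eqVal y).trans_eq (eqVal_obj_self P y)
  refine ⟨hs.le y, res P hy y.2, ?_⟩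
  rw [unitApp_apply, ← res_unitSection]
  exact (res_eq_res_representable s (eqVal_obj_self P y) le_rfl _ hy).symm

theorem IsSheaf.isIso_unitApp {P : Hᵒᵖ ⥤ Type u} (hP : IsSheaf P) : IsIso (unitApp P) :=
  isIso_of_injective_of_locally_surjective hP (Theta.isSheaf _).isSeparated (unitApp P)
    hP.isSeparated.injective_unitApp fun _ => unitApp_locally_surjective P

variable (H) in
/-- The equivalence `SHV(H) ≌ Rel_inf` to which `Δ ⊣ Θ` restricts. -/
noncomputable def sheafEquivalence : SHV H ≌ RelInf H :=
  let adj : IsSheaf.ι ⋙ Delta H ⊣ IsSheaf.lift (Theta H) Theta.isSheaf :=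
    (deltaThetaAdj H).restrictFullyFaithful IsSheaf.fullyFaithfulι (.id _) (Iso.refl _)
      (Iso.refl _)
  haveI (P : SHV H) : IsIso (adj.unit.app P) := by
    have : IsIso ((deltaThetaAdj H).unit.app (IsSheaf.ι.obj P)) := P.property.isIso_unitApp
    have : IsIso (IsSheaf.ι.map (adj.unit.app P)) := by
      rw [Adjunction.map_restrictFullyFaithful_unit_app]
      infer_instance
    exact isIso_of_fully_faithful IsSheaf.ι _
  haveI (F : RelInf H) : IsIso (adj.counit.app F) := by
    have : IsIso ((deltaThetaAdj H).counit.app ((𝟭 (RelInf H)).obj F)) := isIso_counitApp F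
    have : IsIso ((𝟭 (RelInf H)).map (adj.counit.app F)) := by
      rw [Adjunction.map_restrictFullyFaithful_counit_app]
      infer_instance
    exact this
  adj.toEquivalence

end RelSheaf

theorem mainTheorem1 (H : Type u) [Order.Frame H] :
    ∃ adj : RelSheaf.Delta H ⊣ RelSheaf.Theta H,
      -- the unit sends `x ∈ P(h)` to the representable singleton morphism of `x`
      (∀ (P : Hᵒᵖ ⥤ Type u) (h : H) (x : P.obj (op h)) (l : H) (y : Σ k : H, P.obj (op k)),
        (RelSheaf.RelInf.tr ((adj.unit.app P).app (op h) x)).rel l y PUnit.unit ↔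
          ((RelSheaf.Delta H).obj P).fam.rel l y ⟨h, x⟩) ∧
      (∀ F : RelSheaf.RelInf H, IsIso (adj.unit.app ((RelSheaf.Theta H).obj F))) ∧
      ∃ (hΘ : ∀ F : RelSheaf.RelInf H, RelSheaf.IsSheaf ((RelSheaf.Theta H).obj F))
        (e : RelSheaf.SHV H ≌ RelSheaf.RelInf H),
        e.functor = RelSheaf.IsSheaf.ι ⋙ RelSheaf.Delta H ∧
        e.inverse = RelSheaf.IsSheaf.lift (RelSheaf.Theta H) hΘ :=
  ⟨RelSheaf.deltaThetaAdj H,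
    fun P _ x l y => RelSheaf.rel_tr_deltaThetaAdj_unit P x l y,
    fun F => (RelSheaf.Theta.isSheaf F).isIso_unitApp,
    RelSheaf.Theta.isSheaf, RelSheaf.sheafEquivalence H, rfl, rfl⟩
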